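/- Let $Q$ be a nonempty finite alphabet, $q=|Q|$, and let $Q^{\mathbb Z}$ be the space of bi-infinite sequences with the product $\sigma$-algebra of the discrete $\sigma$-algebra on $Q$, with coordinates $X_i$ and shift $(Tx)_j=x_{j+1}$. Write $[n]=\{0,1,\dots,n-1\}$ and $X_{a+[n]}=(X_a,\dots,X_{a+n-1})$. All Shannon entropies are taken with logarithms to the base $q$ (if $q=1$, all entropies are $0$). For a $T$-invariant probability measure $\mu$ on $Q^{\mathbb Z}$ let $$h(\mu)=\lim_{n\to\infty}\frac1n H_\mu(X_{[n]}),\qquad H_\mu(X_{[n]})=-\sum_{w\in Q^n}\mu(X_{[n]}=w)\log_q\mu(X_{[n]}=w),\quad 0\log_q 0=0.$$ Let $\epsilon>0$ and let $k,l\ge 0$ be integers. A $T$-invariant probability measure $\mu$ on $Q^{\mathbb Z}$ is called $(\epsilon,k,l)$-recoverable if $$H_\mu\bigl(X_{l+[k]}\,\big|\,X_{[l]}=\alpha,\ X_{l+k+[l]}=\beta\bigr)\le\epsilon$$ for all $\alpha,\beta\in Q^l$ such that the event $\{X_{[l]}=\alpha,\ X_{l+k+[l]}=\beta\}$ has positive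 $\mu$-probability; the left-hand side is the Shannon entropy of $X_{l+[k]}$ under $\mu$ conditioned on this event. Let $\mathcal M_r^{(\epsilon,k,l)}(Q^{\mathbb Z})$ be the set of all such measures. Then the limit defining $h(\mu)$ exists for every $\mu\in\mathcal M_r^{(\epsilon,k,l)}(Q^{\mathbb Z})$, and $\mathcal M_r^{(\epsilon,k,l)}(Q^{\mathbb Z})$ contains a measure whose entropy attains the (finite) supremum $$\sup_{\mu\in\mathcal M_r^{(\epsilon,k,l)}(Q^{\mathbb Z})}h(\mu).$$ -/

import Mathlib

open MeasureTheory ProbabilityTheory Filter Topology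

namespace RecoverableSystems

/-- The left shift `T` on bi-infinite sequences: `(T x)_j = x_{j+1}`. -/
def shift {Q : Type*} (x : ℤ → Q) : ℤ → Q := fun j => x (j + 1)

/-- The word `x_{a+[n]} = (x_a, x_{a+1}, …, x_{a+n-1})`. -/
def block {Q : Type*} (a : ℤ) (n : ℕ) (x : ℤ → Q) : Fin n → Q := fun i => x (a + (i : ℤ))

/-- The cylinder set of all `x` with `x_{a+[n]} = w`. -/
def cylinderSet {Q : Type*} (a : ℤ) {n : ℕ} (w : Fin n → Q) : Set (ℤ → Q) :=
  {x | block a n x = w}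

/-- The Shannon entropy `H_μ(X_{a+[n]})`, with logarithms to the base `q = |Q|`, of the word
of length `n` starting at coordinate `a` (with the usual convention `0 log 0 = 0`). -/
noncomputable def blockEntropy {Q : Type*} [Fintype Q] [MeasurableSpace Q]
    (μ : Measure (ℤ → Q)) (a : ℤ) (n : ℕ) : ℝ :=
  -∑ w : Fin n → Q, μ.real (cylinderSet a w) *
    Real.logb (Fintype.card Q) (μ.real (cylinderSet a w))

/-- The sequence `(1/n) H_μ([n])` whose limit is the entropy of `μ`. -/
noncomputable def entropyRate {Q : Type*} [Fintype Q] [MeasurableSpace Q]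
    (μ : Measure (ℤ → Q)) (n : ℕ) : ℝ :=
  (1 / (n : ℝ)) * blockEntropy μ 0 n

/-- The metric entropy `h(μ) = lim_n (1/n) H_μ([n])`. -/
noncomputable def metricEntropy {Q : Type*} [Fintype Q] [MeasurableSpace Q]
    (μ : ProbabilityMeasure (ℤ → Q)) : ℝ :=
  limUnder atTop (entropyRate (μ : Measure (ℤ → Q)))

/-- The event `X_{[l]} = α, X_{l+k+[l]} = β`. -/
def contextEvent {Q : Type*} (k : ℕ) {l : ℕ} (α β : Fin l → Q) : Set (ℤ → Q) :=
  cylinderSet 0 α ∩ cylinderSet ((l : ℤ) + (k : ℤ)) β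

/-- `(ε,k,l)`-recoverable measures: shift-invariant probability measures on `Q^ℤ` such that
`H_μ(X_{l+[k]} | X_{[l]} = α, X_{l+k+[l]} = β) ≤ ε` for all words `α, β` of length `l` for which
the conditioning event has positive probability. -/
def recoverableMeasures (Q : Type*) [Fintype Q] [MeasurableSpace Q] (ε : ℝ) (k l : ℕ) :
    Set (ProbabilityMeasure (ℤ → Q)) :=
  {μ | MeasurePreserving shift (μ : Measure (ℤ → Q)) (μ : Measure (ℤ → Q)) ∧
    ∀ α β : Fin l → Q, (μ : Measure (ℤ → Q)) (contextEvent k α β) ≠ 0 →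
      blockEntropy (cond (μ : Measure (ℤ → Q)) (contextEvent k α β)) (l : ℤ) k ≤ ε}

end RecoverableSystems

namespace RecoverableSystems

/-! An upper semicontinuous function on a nonempty compact set attains its maximum. With the
discrete topology on `Q`, the space of sequences is compact metrizable, so its probability measures
are weakly compact. Cylinders are clopen, so their probabilities depend continuously on the measure.
Violating a recoverability constraint is an open condition, so the recoverable measures are closed
(`isClosed_recoverableMeasures`). Block entropies are subadditive, so by Fekete's lemma `h` is an
infimum of continuous functions on the invariant measures, hence upper semicontinuous
(`upperSemicontinuousOn_metricEntropy`). -/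

/-- Subadditivity of Shannon entropy for a joint distribution on a finite product. -/
lemma sum_negMulLog_le_add_marginals {U V : Type*} [Fintype U] [Fintype V] (p : U → V → ℝ)
    (hp : ∀ u v, 0 ≤ p u v) (hsum : ∑ u, ∑ v, p u v = 1) :
    ∑ u, ∑ v, Real.negMulLog (p u v) ≤
      ∑ u, Real.negMulLog (∑ v, p u v) + ∑ v, Real.negMulLog (∑ u, p u v) := by
  set a : U → ℝ := fun u => ∑ v, p u v with ha
  set b : V → ℝ := fun v => ∑ u, p u v with hb
  have hbsum : ∑ v, b v = 1 := by rw [hb, Finset.sum_comm]; exact hsum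
  -- This is `log t ≤ t - 1` at `t = a u * b v / p u v`, multiplied by `p u v`; the last bracket
  -- sums to zero over all pairs.
  have hterm : ∀ u v, Real.negMulLog (p u v) ≤
      -(p u v * Real.log (a u)) + -(p u v * Real.log (b v)) + (a u * b v - p u v) := by
    intro u v
    have hpa : p u v ≤ a u := Finset.single_le_sum (fun v _ => hp u v) (Finset.mem_univ v)
    have hpb : p u v ≤ b v :=
      Finset.single_le_sum (f := fun u => p u v) (fun u _ => hp u v) (Finset.mem_univ u)
    rcases (hp u v).eq_or_lt with h0 | h0
    · rw [← h0] at hpa hpb ⊢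
      simpa using mul_nonneg hpa hpb
    · have hapos := h0.trans_le hpa
      have hbpos := h0.trans_le hpb
      have hlog := Real.log_le_sub_one_of_pos (div_pos (mul_pos hapos hbpos) h0)
      rw [Real.log_div (mul_pos hapos hbpos).ne' h0.ne', Real.log_mul hapos.ne' hbpos.ne'] at hlog
      have h := mul_le_mul_of_nonneg_left hlog h0.le
      have hcancel : p u v * (a u * b v / p u v - 1) = a u * b v - p u v := by
        field_simp
      rw [hcancel] at h
      rw [Real.negMulLog]
      linarith
  have hA : ∑ u, ∑ v, -(p u v * Real.log (a u)) = ∑ u, Real.negMulLog (a u) := by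
    refine Finset.sum_congr rfl fun u _ => ?_
    rw [Finset.sum_neg_distrib, ← Finset.sum_mul, Real.negMulLog, neg_mul]
  have hB : ∑ u, ∑ v, -(p u v * Real.log (b v)) = ∑ v, Real.negMulLog (b v) := by
    rw [Finset.sum_comm]
    refine Finset.sum_congr rfl fun v _ => ?_
    rw [Finset.sum_neg_distrib, ← Finset.sum_mul, Real.negMulLog, neg_mul]
  have hC : ∑ u, ∑ v, (a u * b v - p u v) = 0 := by
    simp_rw [Finset.sum_sub_distrib, ← Finset.mul_sum, hbsum, mul_one]
    exact sub_self _
  calc ∑ u, ∑ v, Real.negMulLog (p u v)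
      ≤ ∑ u, ∑ v, (-(p u v * Real.log (a u)) + -(p u v * Real.log (b v))
          + (a u * b v - p u v)) :=
        Finset.sum_le_sum fun u _ => Finset.sum_le_sum fun v _ => hterm u v
    _ = _ := by
        simp_rw [Finset.sum_add_distrib]
        rw [hA, hB, hC, add_zero]

/-! ### Block entropies and Fekete's lemma -/

section Cylinders

variable {Q : Type*}

lemma preimage_shift_cylinderSet (a : ℤ) {n : ℕ} (w : Fin n → Q) :
    shift ⁻¹' cylinderSet a w = cylinderSet (a + 1) w := by
  ext x
  simp only [cylinderSet, Set.mem_preimage, Set.mem_ofPred_eq, funext_iff, block, shift]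
  refine forall_congr' fun i => ?_
  rw [add_right_comm]

lemma cylinderSet_append (a : ℤ) {m n : ℕ} (u : Fin m → Q) (v : Fin n → Q) :
    cylinderSet a (Fin.append u v) = cylinderSet a u ∩ cylinderSet (a + m) v := by
  ext x
  simp only [cylinderSet, Set.mem_inter_iff, Set.mem_ofPred_eq, funext_iff, block]
  rw [Fin.forall_fin_add]
  simp [add_assoc]

lemma measurable_block [MeasurableSpace Q] (a : ℤ) (n : ℕ) :
    Measurable (block a n : (ℤ → Q) → Fin n → Q) :=
  measurable_pi_lambda _ fun _ => measurable_pi_apply _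

lemma measurable_shift [MeasurableSpace Q] : Measurable (shift : (ℤ → Q) → ℤ → Q) :=
  measurable_pi_lambda _ fun _ => measurable_pi_apply _

lemma continuous_shift [TopologicalSpace Q] : Continuous (shift : (ℤ → Q) → ℤ → Q) :=
  continuous_pi fun _ => continuous_apply _

lemma isClopen_cylinderSet [TopologicalSpace Q] [DiscreteTopology Q] (a : ℤ) {n : ℕ}
    (w : Fin n → Q) : IsClopen (cylinderSet a w) :=
  (isClopen_discrete {w}).preimage (continuous_pi fun _ => continuous_apply _ :
    Continuous (block a n : (ℤ → Q) → Fin n → Q))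

lemma isClopen_contextEvent [TopologicalSpace Q] [DiscreteTopology Q] (k : ℕ) {l : ℕ}
    (α β : Fin l → Q) : IsClopen (contextEvent k α β) :=
  (isClopen_cylinderSet _ _).inter (isClopen_cylinderSet _ _)

variable [Fintype Q] [MeasurableSpace Q]

/-- `negMulLog` is continuous even at 0. When `q = 1` the divisor is 0, and `x / 0 = 0` gives the
convention that entropies vanish. -/
lemma blockEntropy_eq_sum_negMulLog (μ : Measure (ℤ → Q)) (a : ℤ) (n : ℕ) :
    blockEntropy μ a n =
      (∑ w : Fin n → Q, Real.negMulLog (μ.real (cylinderSet a w))) / Real.log (Fintype.card Q) := by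
  rw [blockEntropy, Finset.sum_div, ← Finset.sum_neg_distrib]
  refine Finset.sum_congr rfl fun w _ => ?_
  rw [Real.negMulLog, Real.logb]
  ring

lemma entropyRate_eq_div (μ : Measure (ℤ → Q)) :
    entropyRate μ = fun n : ℕ => blockEntropy μ 0 n / n :=
  funext fun n => by rw [entropyRate]; ring

lemma blockEntropy_nonneg (μ : Measure (ℤ → Q)) [IsProbabilityMeasure μ] (a : ℤ) (n : ℕ) :
    0 ≤ blockEntropy μ a n := by
  rw [blockEntropy_eq_sum_negMulLog]
  exact div_nonneg (Finset.sum_nonneg fun w _ =>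
    Real.negMulLog_nonneg measureReal_nonneg measureReal_le_one) (Real.log_natCast_nonneg _)

lemma bddBelow_range_blockEntropy_div (μ : Measure (ℤ → Q)) [IsProbabilityMeasure μ] :
    BddBelow (Set.range fun n : ℕ => blockEntropy μ 0 n / n) :=
  ⟨0, by rintro _ ⟨n, rfl⟩; exact div_nonneg (blockEntropy_nonneg μ 0 n) n.cast_nonneg⟩

variable [DiscreteMeasurableSpace Q]

lemma measurableSet_cylinderSet (a : ℤ) {n : ℕ} (w : Fin n → Q) :
    MeasurableSet (cylinderSet a w) :=
  measurable_block a n (measurableSet_singleton w)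

lemma measurableSet_contextEvent (k : ℕ) {l : ℕ} (α β : Fin l → Q) :
    MeasurableSet (contextEvent k α β) :=
  (measurableSet_cylinderSet _ _).inter (measurableSet_cylinderSet _ _)

lemma sum_measureReal_inter_cylinderSet (μ : Measure (ℤ → Q)) [IsFiniteMeasure μ] (a : ℤ) (n : ℕ)
    (S : Set (ℤ → Q)) :
    ∑ w : Fin n → Q, μ.real (cylinderSet a w ∩ S) = μ.real S := by
  have h := sum_measureReal_preimage_singleton (μ := μ.restrict S) (f := block a n)
    (Finset.univ : Finset (Fin n → Q)) fun w _ => measurableSet_cylinderSet a w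
  have huniv : (μ.restrict S).real Set.univ = μ.real S := by
    simp [Measure.real]
  rw [Finset.coe_univ, Set.preimage_univ, huniv] at h
  rw [← h]
  exact Finset.sum_congr rfl fun w _ =>
    (measureReal_restrict_apply (measurableSet_cylinderSet a w)).symm

lemma sum_measureReal_cylinderSet (μ : Measure (ℤ → Q)) [IsProbabilityMeasure μ] (a : ℤ) (n : ℕ) :
    ∑ w : Fin n → Q, μ.real (cylinderSet a w) = 1 := by
  simpa using sum_measureReal_inter_cylinderSet μ a n Set.univ

lemma blockEntropy_add_le (μ : Measure (ℤ → Q)) [IsProbabilityMeasure μ] (a : ℤ) (m n : ℕ) :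
    blockEntropy μ a (m + n) ≤ blockEntropy μ a m + blockEntropy μ (a + m) n := by
  simp_rw [blockEntropy_eq_sum_negMulLog, ← add_div]
  refine div_le_div_of_nonneg_right ?_ (Real.log_natCast_nonneg _)
  have hV : ∀ u : Fin m → Q, ∑ v : Fin n → Q,
      μ.real (cylinderSet a u ∩ cylinderSet (a + m) v) = μ.real (cylinderSet a u) := fun u => by
    simp_rw [Set.inter_comm (cylinderSet a u)]
    exact sum_measureReal_inter_cylinderSet μ _ _ _
  have hU : ∀ v : Fin n → Q, ∑ u : Fin m → Q,
      μ.real (cylinderSet a u ∩ cylinderSet (a + m) v) = μ.real (cylinderSet (a + m) v) :=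
    fun v => sum_measureReal_inter_cylinderSet μ _ _ _
  have h := sum_negMulLog_le_add_marginals
    (fun (u : Fin m → Q) (v : Fin n → Q) => μ.real (cylinderSet a u ∩ cylinderSet (a + m) v))
    (fun _ _ => measureReal_nonneg) (by simp_rw [hV]; exact sum_measureReal_cylinderSet μ a m)
  simp_rw [hV, hU] at h
  refine le_of_eq_of_le ?_ h
  rw [← Fintype.sum_prod_type', ← (Fin.appendEquiv m n).sum_comp]
  exact Finset.sum_congr rfl fun uv _ => by
    rw [← cylinderSet_append]
    rfl

lemma blockEntropy_eq_of_measurePreserving {μ : Measure (ℤ → Q)}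
    (hμ : MeasurePreserving shift μ μ) (m n : ℕ) : blockEntropy μ m n = blockEntropy μ 0 n := by
  induction m with
  | zero => rfl
  | succ m ih =>
    rw [← ih]
    simp only [blockEntropy, Nat.cast_succ, ← preimage_shift_cylinderSet]
    simp only [hμ.measureReal_preimage (measurableSet_cylinderSet _ _).nullMeasurableSet]

lemma subadditive_blockEntropy {μ : Measure (ℤ → Q)} [IsProbabilityMeasure μ]
    (hμ : MeasurePreserving shift μ μ) : Subadditive (blockEntropy μ 0) := fun m n => by
  have h := blockEntropy_add_le μ 0 m n
  rwa [zero_add, blockEntropy_eq_of_measurePreserving hμ] at h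

lemma tendsto_entropyRate {μ : ProbabilityMeasure (ℤ → Q)}
    (hμ : MeasurePreserving shift (μ : Measure (ℤ → Q)) (μ : Measure (ℤ → Q))) :
    Tendsto (entropyRate (μ : Measure (ℤ → Q))) atTop (𝓝 (metricEntropy μ)) := by
  refine tendsto_nhds_limUnder ⟨(subadditive_blockEntropy hμ).lim, ?_⟩
  rw [entropyRate_eq_div]
  exact (subadditive_blockEntropy hμ).tendsto_lim (bddBelow_range_blockEntropy_div _)

/-- The Fekete limit is the infimum over `n ≥ 1`; at `n = 0` the rate is 0 by the division
convention, so the bound could fail. -/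
lemma metricEntropy_le_entropyRate {μ : ProbabilityMeasure (ℤ → Q)}
    (hμ : MeasurePreserving shift (μ : Measure (ℤ → Q)) (μ : Measure (ℤ → Q))) {n : ℕ}
    (hn : n ≠ 0) : metricEntropy μ ≤ entropyRate (μ : Measure (ℤ → Q)) n := by
  have hbdd := bddBelow_range_blockEntropy_div (μ : Measure (ℤ → Q))
  have hlim := tendsto_entropyRate hμ
  rw [entropyRate_eq_div] at hlim ⊢
  rw [tendsto_nhds_unique hlim ((subadditive_blockEntropy hμ).tendsto_lim hbdd)]
  exact (subadditive_blockEntropy hμ).lim_le_div hbdd hn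

-- The point mass at a constant sequence is invariant, and its conditional word probabilities are
-- all 0 or 1.
variable (Q) in
lemma recoverableMeasures_nonempty [Nonempty Q] {ε : ℝ} (hε : 0 ≤ ε) (k l : ℕ) :
    (recoverableMeasures Q ε k l).Nonempty := by
  let c : Q := Classical.arbitrary Q
  refine ⟨⟨Measure.dirac fun _ => c, inferInstance⟩, ⟨measurable_shift, ?_⟩, fun α β h => le_of_eq_of_le ?_ hε⟩
  · exact Measure.map_dirac' measurable_shift _
  · change Measure.dirac (fun _ : ℤ => c) (contextEvent k α β) ≠ 0 at h
    change blockEntropy (cond (Measure.dirac fun _ : ℤ => c) (contextEvent k α β)) l k = 0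
    have hE := measurableSet_contextEvent k α β
    have hmem : (fun _ : ℤ => c) ∈ contextEvent k α β := by
      by_contra hc
      exact h (by simp [Measure.dirac_apply' _ hE, hc])
    rw [blockEntropy, neg_eq_zero]
    refine Finset.sum_eq_zero fun w _ => ?_
    have hw := measurableSet_cylinderSet (l : ℤ) w
    rw [Measure.real, cond_apply' hw, Measure.dirac_apply' _ hE,
      Measure.dirac_apply' _ (hE.inter hw)]
    by_cases hc : (fun _ : ℤ => c) ∈ cylinderSet (l : ℤ) w <;> simp [hmem, hc]

end Cylinders

/-! ### Continuity in the weak topology -/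

section WeakTopology

variable {Q : Type*} [Fintype Q] [MeasurableSpace Q] [DiscreteMeasurableSpace Q]
  [TopologicalSpace Q] [DiscreteTopology Q]

/-- A clopen set has empty frontier, so the portmanteau theorem applies at every measure. -/
lemma continuous_measureReal_of_isClopen {Ω : Type*} [TopologicalSpace Ω] [MeasurableSpace Ω]
    [OpensMeasurableSpace Ω] [HasOuterApproxClosed Ω] {S : Set Ω} (hS : IsClopen S) :
    Continuous fun μ : ProbabilityMeasure Ω => (μ : Measure Ω).real S := by
  refine continuous_iff_continuousAt.2 fun μ => ?_
  exact (ENNReal.tendsto_toReal (measure_ne_top _ _)).comp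
    (ProbabilityMeasure.tendsto_measure_of_null_frontier_of_tendsto' tendsto_id
      (by rw [hS.frontier_eq, measure_empty]))

lemma continuous_entropyRate (n : ℕ) :
    Continuous fun μ : ProbabilityMeasure (ℤ → Q) => entropyRate (μ : Measure (ℤ → Q)) n := by
  simp_rw [entropyRate, blockEntropy_eq_sum_negMulLog]
  refine continuous_const.mul (Continuous.div_const (continuous_finsetSum _ fun w _ => ?_) _)
  exact Real.continuous_negMulLog.comp (continuous_measureReal_of_isClopen
    (isClopen_cylinderSet 0 w))

lemma continuousAt_blockEntropy_cond {E : Set (ℤ → Q)} (hE : IsClopen E) (a : ℤ) (n : ℕ)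
    {μ : ProbabilityMeasure (ℤ → Q)} (hμ : (μ : Measure (ℤ → Q)) E ≠ 0) :
    ContinuousAt (fun ν : ProbabilityMeasure (ℤ → Q) =>
      blockEntropy (cond (ν : Measure (ℤ → Q)) E) a n) μ := by
  simp_rw [blockEntropy_eq_sum_negMulLog]
  refine ContinuousAt.div_const (tendsto_finsetSum _ fun w _ => ?_) _
  have hw := measurableSet_cylinderSet a w
  have heq : ∀ ν : ProbabilityMeasure (ℤ → Q), (cond (ν : Measure (ℤ → Q)) E).real
      (cylinderSet a w) = ((ν : Measure (ℤ → Q)).real E)⁻¹ *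
        (ν : Measure (ℤ → Q)).real (E ∩ cylinderSet a w) := fun ν => by
    rw [Measure.real, cond_apply' hw, ENNReal.toReal_mul, ENNReal.toReal_inv]
    rfl
  simp_rw [heq]
  have hne : (μ : Measure (ℤ → Q)).real E ≠ 0 := by
    rwa [Ne, measureReal_eq_zero_iff]
  exact Real.continuous_negMulLog.continuousAt.comp
    (((continuous_measureReal_of_isClopen hE).continuousAt.inv₀ hne).mul
      (continuous_measureReal_of_isClopen (hE.inter (isClopen_cylinderSet a w))).continuousAt)

lemma isClosed_recoverableMeasures (ε : ℝ) (k l : ℕ) :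
    IsClosed (recoverableMeasures Q ε k l) := by
  have hinv : IsClosed {μ : ProbabilityMeasure (ℤ → Q) |
      MeasurePreserving shift (μ : Measure (ℤ → Q)) (μ : Measure (ℤ → Q))} := by
    have heq : {μ : ProbabilityMeasure (ℤ → Q) |
        MeasurePreserving shift (μ : Measure (ℤ → Q)) (μ : Measure (ℤ → Q))} =
        {μ | μ.map measurable_shift.aemeasurable = μ} := by
      ext μ
      exact ⟨fun h => Subtype.ext h.map_eq, fun h => ⟨measurable_shift, congrArg Subtype.val h⟩⟩
    rw [heq]
    exact isClosed_eq (ProbabilityMeasure.continuous_map continuous_shift) continuous_id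
  have hcond : ∀ α β : Fin l → Q, IsClosed {μ : ProbabilityMeasure (ℤ → Q) |
      (μ : Measure (ℤ → Q)) (contextEvent k α β) ≠ 0 →
        blockEntropy (cond (μ : Measure (ℤ → Q)) (contextEvent k α β)) (l : ℤ) k ≤ ε} := by
    intro α β
    -- A violating measure charges the context and has conditional entropy strictly above `ε`; both
    -- persist nearby. Contexts of mass zero impose nothing, so the discontinuity of conditioning
    -- there is harmless.
    rw [← isOpen_compl_iff, isOpen_iff_mem_nhds]
    intro μ hμ
    simp only [Set.mem_compl_iff, Set.mem_ofPred_eq, Classical.not_imp, not_le] at hμ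
    obtain ⟨hpos, hlt⟩ := hμ
    have hE := isClopen_contextEvent k α β
    have hne : (μ : Measure (ℤ → Q)).real (contextEvent k α β) ≠ 0 := by
      rwa [Ne, measureReal_eq_zero_iff]
    filter_upwards [(continuousAt_blockEntropy_cond hE l k hpos).eventually_const_lt hlt,
      (continuous_measureReal_of_isClopen hE).continuousAt.eventually_ne hne] with ν h₁ h₂ h₃
    refine not_le.2 h₁ (h₃ fun h => h₂ ?_)
    rw [Measure.real, h, ENNReal.toReal_zero]
  have heq : recoverableMeasures Q ε k l = {μ : ProbabilityMeasure (ℤ → Q) |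
      MeasurePreserving shift (μ : Measure (ℤ → Q)) (μ : Measure (ℤ → Q))} ∩
      ⋂ α : Fin l → Q, ⋂ β : Fin l → Q, {μ : ProbabilityMeasure (ℤ → Q) |
      (μ : Measure (ℤ → Q)) (contextEvent k α β) ≠ 0 →
        blockEntropy (cond (μ : Measure (ℤ → Q)) (contextEvent k α β)) (l : ℤ) k ≤ ε} := by
    ext μ
    simp only [recoverableMeasures, Set.mem_inter_iff, Set.mem_iInter, Set.mem_ofPred_eq]
  rw [heq]
  exact hinv.inter (isClosed_iInter fun α => isClosed_iInter fun β => hcond α β)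

lemma upperSemicontinuousOn_metricEntropy :
    UpperSemicontinuousOn (metricEntropy (Q := Q)) {μ : ProbabilityMeasure (ℤ → Q) |
      MeasurePreserving shift (μ : Measure (ℤ → Q)) (μ : Measure (ℤ → Q))} := by
  intro μ hμ y hy
  -- One finite `n` with rate below `y` at `μ` bounds `h` below `y` at all nearby invariant
  -- measures.
  obtain ⟨n, hn, hn0⟩ := (((tendsto_entropyRate hμ).eventually_lt_const hy).and
    (eventually_ne_atTop 0)).exists
  filter_upwards [self_mem_nhdsWithin, mem_nhdsWithin_of_mem_nhds
    ((continuous_entropyRate n).continuousAt.eventually_lt_const hn)] with ν hν hlt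
  exact (metricEntropy_le_entropyRate hν hn0).trans_lt hlt

end WeakTopology

end RecoverableSystems

theorem mainTheorem8 {Q : Type*} [Fintype Q] [Nonempty Q] [MeasurableSpace Q]
    [DiscreteMeasurableSpace Q] (ε : ℝ) (hε : 0 < ε) (k l : ℕ) :
    (∀ μ ∈ RecoverableSystems.recoverableMeasures Q ε k l,
      Tendsto (RecoverableSystems.entropyRate (μ : Measure (ℤ → Q))) atTop
        (𝓝 (RecoverableSystems.metricEntropy μ))) ∧
    ∃ μ ∈ RecoverableSystems.recoverableMeasures Q ε k l,
      IsLUB (RecoverableSystems.metricEntropy '' RecoverableSystems.recoverableMeasures Q ε k l)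
        (RecoverableSystems.metricEntropy μ) := by
  refine ⟨fun μ hμ => RecoverableSystems.tendsto_entropyRate hμ.1, ?_⟩
  let _ : TopologicalSpace Q := ⊥
  have : DiscreteTopology Q := ⟨rfl⟩
  obtain ⟨μ, hμ, hmax⟩ := UpperSemicontinuousOn.exists_isMaxOn
    (RecoverableSystems.recoverableMeasures_nonempty Q hε.le k l)
    (RecoverableSystems.isClosed_recoverableMeasures ε k l).isCompact
    (RecoverableSystems.upperSemicontinuousOn_metricEntropy.mono fun _ hν => hν.1)
  refine ⟨μ, hμ, IsGreatest.isLUB ⟨Set.mem_image_of_mem _ hμ, ?_⟩⟩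
  rintro _ ⟨ν, hν, rfl⟩
  exact hmax hν
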